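/- A \emph{parity game} $G=(V,V_E,V_A,E,\Omega)$ is a directed graph $(V,E)$ in which every position has at least one successor, with a partition $V=V_E\sqcup V_A$ of the positions between the players Eve and Adam and a priority assignment $\Omega:V\to\{0,\dots,d\}$. A play is an infinite path; Eve wins it if the highest priority that occurs infinitely often is even, otherwise Adam wins it. A (positional) strategy of a player maps each position of that player to one of its successors; it is winning from $v$ if the player wins every play from $v$ that agrees with it. The winning region of a player is the set of positions from which that player has a winning strategy. Parity games with priorities on edges (with parallel edges allowed, a strategy choosing outgoing edges) are treated in the same way. For $k\in\mathbb N$ and a player $C$, the \emph{$k$-register game} on $G$ with $C$ in control of the registers is the following parity game with priorities on edges. Its positions are the triples $(v,\bar r,t)$ with $v\in V$, $\bar r=(r_0,\dots,r_k)\in\{0,\dots,d\}^{k+1}$ and $t\in\{0,1\}$. Positions $(v,\bar r,0)$ belong to $C$, and $(v,\bar r,1)$ belongs to the owner of $v$ in $G$. For every edge $(v,w)\in E$ there is an edge from $(v,\bar r,1)$ to $(w,\bar r,0)$ of priority $0$. For every $i\in\{0,\dots,k\}$ there is an edge from $(v,\bar r,0)$ to $(v,\bar r',1)$, where $r'_j=\max(r_j,\Omega(v))$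 for $j>i$, $r'_i=\Omega(v)$, and $r'_j=0$ for $j<i$; its priority is $2i+1$ if $\max(r_i,\Omega(v))$ is odd, and if $\max(r_i,\Omega(v))$ is even it is $2i$ when $C$ is Eve and $2i+2$ when $C$ is Adam. We say that $C$ wins this game from $v$ if $C$ has a winning strategy from $(v,\bar r,t)$ for all $\bar r$ and $t$. A position $v$ in the winning region in $G$ of a player $C$ has \emph{register-index} $k$ if $k$ is the least integer such that $C$ wins from $v$ the $k$-register game on $G$ with $C$ in control of the registers. The \emph{register-index} of $G$ is the least $k$ such that every position of $G$ has a register-index that is at most $k$. The \emph{dc-size} of a finite parity game is the maximal number of pairwise vertex-disjoint (directed, simple) cycles in $(V,E)$, self-loops being cycles. \textbf{Theorem.} Let $G$ be a finite parity game with at least one position, and let $z$ be its dc-size. Then $G$ has a register-index $k$, and $k\le 1+\log_2 z$. -/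

import Mathlib

open Filter

/-- The two players. -/
inductive Player where
  | eve
  | adam
  deriving DecidableEq

/-- The parity condition on an infinite sequence of priorities: the highest priority that occurs
infinitely often is even. -/
def ParityCondition (c : ℕ → ℕ) : Prop :=
  ∃ p, Even p ∧ (∃ᶠ n in atTop, c n = p) ∧ ∀ q, (∃ᶠ n in atTop, c n = q) → q ≤ p

/-- Eve wins a play iff its sequence of priorities satisfies the parity condition; otherwise
Adam wins it. -/
def Player.WinsSequence : Player → (ℕ → ℕ) → Prop
  | .eve, c => ParityCondition c
  | .adam, c => ¬ ParityCondition c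

/-- A parity game with priorities on positions, on a possibly infinite arena. Priorities lie in
`{0, …, maxPriority}` (games whose co-domain starts at `1` are those that never use `0`), and
every position has a successor. -/
structure ParityGame (V : Type*) where
  owner : V → Player
  edge : V → V → Prop
  maxPriority : ℕ
  priority : V → Fin (maxPriority + 1)
  exists_succ : ∀ v, ∃ w, edge v w

namespace ParityGame

variable {V : Type*} (G : ParityGame V)

/-- A play: an infinite path in the arena. -/
def IsPlay (π : ℕ → V) : Prop :=
  ∀ n, G.edge (π n) (π (n + 1))

/-- `σ` is a positional strategy for `P` (its values at positions of the opponent are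
irrelevant). -/
def IsStrategy (P : Player) (σ : V → V) : Prop :=
  ∀ v, G.owner v = P → G.edge v (σ v)

/-- The play `π` agrees with the strategy `σ` of `P`. -/
def Agrees (P : Player) (σ : V → V) (π : ℕ → V) : Prop :=
  ∀ n, G.owner (π n) = P → π (n + 1) = σ (π n)

/-- The winning region of `P`: the positions from which `P` has a winning strategy. -/
def winningRegion (P : Player) : Set V :=
  {v | ∃ σ, G.IsStrategy P σ ∧
    ∀ π, G.IsPlay π → π 0 = v → G.Agrees P σ π →
      P.WinsSequence fun n => (G.priority (π n) : ℕ)}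

end ParityGame

/-- A parity game with priorities on edges. There may be parallel edges with different
priorities: `edge v p w` says that there is an edge of priority `p` from `v` to `w`. -/
structure EdgeParityGame (V : Type*) where
  owner : V → Player
  edge : V → ℕ → V → Prop
  maxPriority : ℕ
  priority_le : ∀ v p w, edge v p w → p ≤ maxPriority
  exists_succ : ∀ v, ∃ p w, edge v p w

namespace EdgeParityGame

variable {V : Type*} (G : EdgeParityGame V)

/-- A play, given by its positions `π` and the priorities `c` of the edges it takes. -/
def IsPlay (π : ℕ → V) (c : ℕ → ℕ) : Prop :=
  ∀ n, G.edge (π n) (c n) (π (n + 1))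

/-- `σ` is a positional strategy for `P`: it chooses an outgoing edge (a priority and a target)
at each position of `P`. -/
def IsStrategy (P : Player) (σ : V → ℕ × V) : Prop :=
  ∀ v, G.owner v = P → G.edge v (σ v).1 (σ v).2

/-- The play `(π, c)` agrees with the strategy `σ` of `P`. -/
def Agrees (P : Player) (σ : V → ℕ × V) (π : ℕ → V) (c : ℕ → ℕ) : Prop :=
  ∀ n, G.owner (π n) = P → (c n, π (n + 1)) = σ (π n)

/-- The winning region of `P`: the positions from which `P` has a winning strategy. -/
def winningRegion (P : Player) : Set V :=
  {v | ∃ σ, G.IsStrategy P σ ∧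
    ∀ π c, G.IsPlay π c → π 0 = v → G.Agrees P σ π c → P.WinsSequence c}

end EdgeParityGame

namespace ParityGame

variable {V : Type*} (G : ParityGame V)

/-- Contents of the registers `0, …, k`. -/
abbrev Registers (k : ℕ) : Type :=
  Fin (k + 1) → Fin (G.maxPriority + 1)

/-- The register contents after priority `p` has occurred and register `i` has been chosen. -/
def updateRegisters {k : ℕ} (r : G.Registers k) (p : Fin (G.maxPriority + 1))
    (i : Fin (k + 1)) : G.Registers k :=
  fun j => if i < j then max (r j) p else if j = i then p else 0

/-- The output when register `i` is chosen by the player `C` in control of the registers, where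
`m` is the maximum of the content of register `i` and the current priority. -/
def registerOutput (C : Player) (i m : ℕ) : ℕ :=
  match C with
  | .eve => if Even m then 2 * i else 2 * i + 1
  | .adam => if Even m then 2 * i + 2 else 2 * i + 1

/-- Positions `(v, r, t)` of the `k`-register game: the next step is a choice of register if
`t = false`, and a move in the underlying game if `t = true`. -/
abbrev RegisterPosition (k : ℕ) : Type _ :=
  V × G.Registers k × Bool

/-- The edges of the `k`-register game in which `C` controls the registers. -/
inductive RegisterEdge (k : ℕ) (C : Player) :
    G.RegisterPosition k → ℕ → G.RegisterPosition k → Prop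
  | move (v w : V) (r : G.Registers k) (h : G.edge v w) :
      RegisterEdge k C (v, r, true) 0 (w, r, false)
  | choose (v : V) (r : G.Registers k) (i : Fin (k + 1)) :
      RegisterEdge k C (v, r, false)
        (registerOutput C i (max (r i) (G.priority v) : Fin (G.maxPriority + 1)))
        (v, G.updateRegisters r (G.priority v) i, true)

/-- The `k`-register game on `G` in which `C` controls the registers. -/
def registerGame (k : ℕ) (C : Player) : EdgeParityGame (G.RegisterPosition k) where
  owner x := if x.2.2 then G.owner x.1 else C
  edge := G.RegisterEdge k C
  maxPriority := 2 * k + 2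
  priority_le := by
    rintro _ _ _ (⟨v, w, r, h⟩ | ⟨v, r, i⟩)
    · omega
    · have := i.is_lt
      cases C <;> simp only [registerOutput] <;> split_ifs <;> omega
  exists_succ := by
    rintro ⟨v, r, _ | _⟩
    · exact ⟨_, _, .choose v r 0⟩
    · obtain ⟨w, h⟩ := G.exists_succ v
      exact ⟨_, _, .move v w r h⟩

/-- `C` wins the `k`-register game in which `C` controls the registers from `v`, that is, from
`(v, r, t)` for all register contents `r` and both values of `t`. -/
def WinsRegisterGame (k : ℕ) (C : Player) (v : V) : Prop :=
  ∀ r t, (v, r, t) ∈ (G.registerGame k C).winningRegion C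

/-- `G` has register-index `k` at `v`: the position `v` is in the winning region of one of the
players, and `k` is least such that this player, controlling the registers, wins the
`k`-register game from `v`. -/
def HasRegisterIndexAt (v : V) (k : ℕ) : Prop :=
  (v ∈ G.winningRegion .eve ∧ IsLeast {j | G.WinsRegisterGame j .eve v} k) ∨
    (v ∈ G.winningRegion .adam ∧ IsLeast {j | G.WinsRegisterGame j .adam v} k)

/-- `G` has register-index `k`: `k` is least such that at every position `G` has a register-index
which is at most `k`. -/
def HasRegisterIndex (k : ℕ) : Prop :=
  IsLeast {m | ∀ v, ∃ j ≤ m, G.HasRegisterIndexAt v j} k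

/-- `c` is a (directed, simple) cycle of the arena; self-loops are cycles of length one. -/
def IsCycle (c : Cycle V) : Prop :=
  c ≠ Cycle.nil ∧ c.Nodup ∧ c.Chain G.edge

/-- There are `n` pairwise vertex-disjoint cycles in the arena. -/
def HasDisjointCycles (n : ℕ) : Prop :=
  ∃ c : Fin n → Cycle V, (∀ i, G.IsCycle (c i)) ∧
    ∀ i j, i ≠ j → ∀ v, v ∈ c i → v ∉ c j

/-- The dc-size of (a parity game on) a finite arena: the maximal number of vertex-disjoint
cycles. -/
noncomputable def dcSize : ℕ :=
  sSup {n | G.HasDisjointCycles n}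

end ParityGame

/-! Finite parity games are positionally determined (`isDetermined`), so it suffices that a player P
who wins a region by a positional strategy s also wins there the register game whose top register is
`Nat.size z`, which is 1 + ⌊log₂ z⌋ for z ≥ 1. Let C(v) be the strongly connected component of v in
the graph of s-consistent edges between positions of priority at most Ω(v). In the register game P
follows s and chooses at v the register `registerRank` v, the `Nat.size` of the number of disjoint
cycles in C(v).

Given a play π, let p be its highest recurring priority and v a recurring position of priority p.
From some time on C(π n) ⊆ C(v), so no register above k = `registerRank` v is chosen, while k is
chosen infinitely often. Let m < n be consecutive choices of k. At time n the maximum of register k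
and Ω(π n) is the highest priority on [m, n]. If C(π m) and C(π n) were disjoint, each would
contribute 2^(k-1) disjoint cycles to C(v), which has fewer than 2^k. So they meet, and a path leads
from π n back to π m without exceeding that maximum. This closes an s-consistent walk, so the
maximum has P's parity (`favors_of_registerRank_eq`). Hence all late outputs of register k are good,
and they dominate those of smaller registers. -/

/-! ### Winning sequences of priorities. -/

theorem frequently_atTop_add_iff {q : ℕ → Prop} (N : ℕ) :
    (∃ᶠ n in atTop, q (n + N)) ↔ ∃ᶠ n in atTop, q n := by
  conv_rhs => rw [← map_add_atTop_eq_nat N, frequently_map]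

namespace Player

/-- The opponent of a player. -/
def opponent : Player → Player
  | .eve => .adam
  | .adam => .eve

@[simp] theorem opponent_opponent (P : Player) : P.opponent.opponent = P := by
  cases P <;> rfl

theorem ne_opponent_iff {P Q : Player} : Q ≠ P.opponent ↔ Q = P := by
  cases P <;> cases Q <;> simp [opponent]

/-- The player `P` favors the priorities of her parity. -/
def Favors : Player → ℕ → Prop
  | .eve, p => Even p
  | .adam, p => ¬ Even p

theorem exists_favors (p : ℕ) : ∃ P : Player, P.Favors p := by
  by_cases h : Even p
  · exact ⟨.eve, h⟩
  · exact ⟨.adam, h⟩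

theorem winsSequence_iff_favors {P : Player} {c : ℕ → ℕ} {p : ℕ}
    (hf : ∃ᶠ n in atTop, c n = p) (hle : ∀ᶠ n in atTop, c n ≤ p) :
    P.WinsSequence c ↔ P.Favors p := by
  have key : ParityCondition c ↔ Even p := by
    constructor
    · rintro ⟨q, hq, hfq, hmax⟩
      obtain ⟨n, hn, hn'⟩ := (hfq.and_eventually hle).exists
      rwa [le_antisymm (hmax p hf) (hn ▸ hn')]
    · intro hp
      refine ⟨p, hp, hf, fun q hq => ?_⟩
      obtain ⟨n, hn, hn'⟩ := (hq.and_eventually hle).exists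
      exact hn ▸ hn'
  cases P
  · exact key
  · exact not_congr key

theorem winsSequence_add_iff {P : Player} {c : ℕ → ℕ} (N : ℕ) :
    P.WinsSequence (fun n => c (n + N)) ↔ P.WinsSequence c := by
  have key : ParityCondition (fun n => c (n + N)) ↔ ParityCondition c := by
    have h (q : ℕ) := frequently_atTop_add_iff (q := fun n => c n = q) N
    simp only [ParityCondition, h]
  cases P
  · exact key
  · exact not_congr key

end Player

/-- The least eventual bound is attained infinitely often, since otherwise its predecessor would be
an eventual bound. -/
theorem exists_frequently_eq_and_eventually_le {c : ℕ → ℕ} {B : ℕ} (hB : ∀ n, c n ≤ B) :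
    ∃ p, (∃ᶠ n in atTop, c n = p) ∧ ∀ᶠ n in atTop, c n ≤ p := by
  classical
  have h : ∃ p, ∀ᶠ n in atTop, c n ≤ p := ⟨B, .of_forall hB⟩
  refine ⟨Nat.find h, fun hne => ?_, Nat.find_spec h⟩
  have hlt : ∀ᶠ n in atTop, c n < Nat.find h := by
    filter_upwards [hne, Nat.find_spec h] with n h1 h2
    exact lt_of_le_of_ne h2 h1
  obtain ⟨n, hn⟩ := hlt.exists
  refine Nat.find_min h (m := Nat.find h - 1) (by omega) ?_
  filter_upwards [hlt] with n hn
  omega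

/-! ### Dominions, attractors and positional determinacy. -/

namespace ParityGame

variable {V : Type*} (G : ParityGame V)

/-- Every position of `U` has a successor in `U`. -/
def IsSubarena (U : Set V) : Prop :=
  ∀ v ∈ U, ∃ w ∈ U, G.edge v w

/-- In the subarena `U`, the strategy `s` of `P` keeps the play in `X` and wins there. -/
structure IsDominion (P : Player) (U X : Set V) (s : V → V) : Prop where
  subset : X ⊆ U
  own : ∀ v ∈ X, G.owner v = P → G.edge v (s v) ∧ s v ∈ X
  other : ∀ v ∈ X, G.owner v ≠ P → ∀ w ∈ U, G.edge v w → w ∈ X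
  wins : ∀ π, G.IsPlay π → (∀ n, π n ∈ X) → G.Agrees P s π →
    P.WinsSequence fun n => (G.priority (π n) : ℕ)

/-- In the subarena `U`, the strategy `s` of `P` forces the play from `B` to `N`, decreasing the
rank `ρ` on the way. -/
structure IsAttractor (P : Player) (U N B : Set V) (s : V → V) (ρ : V → ℕ) : Prop where
  target_subset : N ⊆ B
  subset : B ⊆ U
  own : ∀ v ∈ B, v ∉ N → G.owner v = P → G.edge v (s v) ∧ s v ∈ B ∧ ρ (s v) < ρ v
  other : ∀ v ∈ B, v ∉ N → G.owner v ≠ P → ∀ w ∈ U, G.edge v w → w ∈ B ∧ ρ w < ρ v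

/-- In the subarena `U`, the opponent of `P` can keep the play outside of `B`. -/
structure IsTrapComplement (P : Player) (U B : Set V) : Prop where
  own : ∀ v ∈ U, v ∉ B → G.owner v = P → ∀ w ∈ B, ¬ G.edge v w
  other : ∀ v ∈ U, v ∉ B → G.owner v ≠ P → ∃ w ∈ U, w ∉ B ∧ G.edge v w

variable {G}

theorem IsPlay.add {π : ℕ → V} (h : G.IsPlay π) (N : ℕ) : G.IsPlay fun n => π (n + N) := by
  intro n
  have := h (n + N)
  rwa [add_right_comm] at this

theorem Agrees.add {P : Player} {s : V → V} {π : ℕ → V} (h : G.Agrees P s π) (N : ℕ) :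
    G.Agrees P s fun n => π (n + N) := by
  intro n hn
  have := h (n + N) hn
  rwa [add_right_comm] at this

theorem IsDominion.mem_of_agrees {P : Player} {U X : Set V} {s : V → V}
    (h : G.IsDominion P U X s) {π : ℕ → V} (hπ : G.IsPlay π) (hU : ∀ n, π n ∈ U) {N : ℕ}
    (hN : π N ∈ X) (hs : ∀ n, π n ∈ X → G.owner (π n) = P → π (n + 1) = s (π n)) (n : ℕ) :
    π (n + N) ∈ X := by
  induction n with
  | zero => simpa using hN
  | succ n ih =>
    rw [add_right_comm]
    by_cases ho : G.owner (π (n + N)) = P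
    · rw [hs _ ih ho]
      exact (h.own _ ih ho).2
    · exact h.other _ ih ho _ (hU _) (hπ _)

/-- A play that enters X stays there and is won because winning does not depend on a finite prefix.
Hence only plays that avoid X need a separate argument. -/
theorem IsDominion.extend {P : Player} {U X Z : Set V} {s u : V → V}
    (h : G.IsDominion P U X s) (hZU : Z ⊆ U) (hu : ∀ v ∈ X, u v = s v)
    (hown : ∀ v ∈ Z, v ∉ X → G.owner v = P → G.edge v (u v) ∧ u v ∈ Z)
    (hother : ∀ v ∈ Z, v ∉ X → G.owner v ≠ P → ∀ w ∈ U, G.edge v w → w ∈ Z)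
    (hXZ : X ⊆ Z)
    (hwins : ∀ π, G.IsPlay π → (∀ n, π n ∈ Z) → (∀ n, π n ∉ X) → G.Agrees P u π →
      P.WinsSequence fun n => (G.priority (π n) : ℕ)) :
    G.IsDominion P U Z u where
  subset := hZU
  own v hv ho := by
    by_cases hX : v ∈ X
    · rw [hu v hX]
      exact ⟨(h.own v hX ho).1, hXZ (h.own v hX ho).2⟩
    · exact hown v hv hX ho
  other v hv ho w hw he := by
    by_cases hX : v ∈ X
    · exact hXZ (h.other v hX ho w hw he)
    · exact hother v hv hX ho w hw he
  wins π hπ hZ ha := by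
    by_cases hX : ∃ N, π N ∈ X
    · obtain ⟨N, hN⟩ := hX
      have hmem := h.mem_of_agrees hπ (fun n => hZU (hZ n)) hN
        fun n hn ho => by rw [ha n ho, hu _ hn]
      rw [← Player.winsSequence_add_iff N]
      refine h.wins _ (hπ.add N) hmem fun n ho => ?_
      exact (ha.add N n ho).trans (hu _ (hmem n))
    · exact hwins π hπ hZ (not_exists.mp hX) ha

theorem IsDominion.union {P : Player} {U X Y : Set V} {s t : V → V}
    (hX : G.IsDominion P U X s) (hY : G.IsDominion P (U \ X) Y t) :
    ∃ u, G.IsDominion P U (X ∪ Y) u := by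
  classical
  refine ⟨fun v => if v ∈ X then s v else t v, hX.extend ?_ ?_ ?_ ?_ ?_ ?_⟩
  · exact Set.union_subset hX.subset (hY.subset.trans Set.sdiff_subset)
  · intro v hv
    simp [hv]
  · rintro v (hv | hv) hv' ho
    · exact absurd hv hv'
    · simp only [hv', if_false]
      exact ⟨(hY.own v hv ho).1, .inr (hY.own v hv ho).2⟩
  · rintro v (hv | hv) hv' ho w hw he
    · exact absurd hv hv'
    · by_cases hwX : w ∈ X
      · exact .inl hwX
      · exact .inr (hY.other v hv ho w ⟨hw, hwX⟩ he)
  · exact Set.subset_union_left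
  · intro π hπ hZ hnX ha
    refine hY.wins π hπ (fun n => (hZ n).resolve_left (hnX n)) fun n ho => ?_
    simp [ha n ho, hnX n]

theorem IsAttractor.exists_mem {P : Player} {U N B : Set V} {s : V → V} {ρ : V → ℕ}
    (h : G.IsAttractor P U N B s ρ) {π : ℕ → V} (hπ : G.IsPlay π) (hU : ∀ n, π n ∈ U)
    (hs : ∀ n, π n ∈ B → π n ∉ N → G.owner (π n) = P → π (n + 1) = s (π n)) (n : ℕ)
    (hn : π n ∈ B) : ∃ m ≥ n, π m ∈ N := by
  induction hk : ρ (π n) using Nat.strong_induction_on generalizing n with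
  | _ k ih =>
    by_cases hN : π n ∈ N
    · exact ⟨n, le_rfl, hN⟩
    have key : π (n + 1) ∈ B ∧ ρ (π (n + 1)) < ρ (π n) := by
      by_cases ho : G.owner (π n) = P
      · rw [hs n hn hN ho]
        exact (h.own _ hn hN ho).2
      · exact h.other _ hn hN ho _ (hU _) (hπ n)
    obtain ⟨m, hm, hmN⟩ := ih _ (hk ▸ key.2) (n + 1) key.1 rfl
    exact ⟨m, by omega, hmN⟩

theorem IsDominion.exists_of_isAttractor {P : Player} {U X B : Set V} {s t : V → V} {ρ : V → ℕ}
    (hX : G.IsDominion P U X s) (hB : G.IsAttractor P U X B t ρ) :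
    ∃ u, G.IsDominion P U B u := by
  classical
  refine ⟨fun v => if v ∈ X then s v else t v, hX.extend hB.subset ?_ ?_ ?_ hB.target_subset ?_⟩
  · intro v hv
    simp [hv]
  · intro v hv hvX ho
    simp only [hvX, if_false]
    exact ⟨(hB.own v hv hvX ho).1, (hB.own v hv hvX ho).2.1⟩
  · intro v hv hvX ho w hw he
    exact (hB.other v hv hvX ho w hw he).1
  · intro π hπ hZ hnX ha
    obtain ⟨m, -, hm⟩ := hB.exists_mem hπ (fun n => hB.subset (hZ n))
      (fun n _ hnX' ho => by simp [ha n ho, hnX']) 0 (hZ 0)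
    exact absurd hm (hnX m)

theorem IsTrapComplement.isSubarena_diff {P : Player} {U B : Set V}
    (h : G.IsTrapComplement P U B) (hU : G.IsSubarena U) : G.IsSubarena (U \ B) := by
  rintro v ⟨hv, hvB⟩
  by_cases ho : G.owner v = P
  · obtain ⟨w, hw, he⟩ := hU v hv
    exact ⟨w, ⟨hw, fun hwB => h.own v hv hvB ho w hwB he⟩, he⟩
  · obtain ⟨w, hw, hwB, he⟩ := h.other v hv hvB ho
    exact ⟨w, ⟨hw, hwB⟩, he⟩

/-- Outside B the player P has no edge into B, so restoring B gives P no new way to leave Y. -/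
theorem IsTrapComplement.isDominion_opponent {P : Player} {U B Y : Set V} {t : V → V}
    (h : G.IsTrapComplement P U B) (hY : G.IsDominion P.opponent (U \ B) Y t) :
    G.IsDominion P.opponent U Y t where
  subset := hY.subset.trans Set.sdiff_subset
  own := hY.own
  other v hv ho w hw he :=
    hY.other v hv ho w ⟨hw, fun hwB => h.own v (hY.subset hv).1 (hY.subset hv).2
      (Player.ne_opponent_iff.mp ho) w hwB he⟩ he
  wins := hY.wins

/-- The attractor is obtained as a maximal set with a decreasing rank instead of by iteration: a
position violating the trap conditions could be added to it. -/
theorem exists_isAttractor [Finite V] (P : Player) {U N : Set V} (hN : N ⊆ U) :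
    ∃ B s ρ, G.IsAttractor P U N B s ρ ∧ G.IsTrapComplement P U B := by
  classical
  have hmem : N ∈ {B | ∃ s ρ, G.IsAttractor P U N B s ρ} :=
    ⟨id, 0, subset_rfl, hN, fun v hv hv' => absurd hv hv', fun v hv hv' => absurd hv hv'⟩
  obtain ⟨B, -, ⟨s, ρ, hB⟩, hmax⟩ :=
    (Set.toFinite {B | ∃ s ρ, G.IsAttractor P U N B s ρ}).exists_le_maximal hmem
  have hins : ∀ v ∈ U, v ∉ B → ∀ x, (G.owner v = P → G.edge v x ∧ x ∈ B) →
      (G.owner v ≠ P → ∀ w ∈ U, G.edge v w → w ∈ B) → False := by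
    intro v hv hvB x hown hother
    -- The added position gets a rank above all existing ones, so the rank still decreases along its
    -- moves.
    obtain ⟨M, hM⟩ := (Set.finite_range ρ).bddAbove
    have hM' : ∀ w, ρ w < M + 1 := fun w => Nat.lt_succ_of_le (hM ⟨w, rfl⟩)
    refine hvB (hmax (y := insert v B) ⟨Function.update s v x, Function.update ρ v (M + 1),
      hB.target_subset.trans (Set.subset_insert _ _), Set.insert_subset hv hB.subset, ?_, ?_⟩
      (Set.subset_insert _ _) (Set.mem_insert _ _))
    · rintro u (rfl | hu) huN ho
      · have hxu : x ≠ u := fun h => hvB (h ▸ (hown ho).2)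
        simp only [Function.update_self, Function.update_of_ne hxu]
        exact ⟨(hown ho).1, .inr (hown ho).2, hM' x⟩
      · have huv : u ≠ v := fun h => hvB (h ▸ hu)
        obtain ⟨h1, h2, h3⟩ := hB.own u hu huN ho
        have hsv : s u ≠ v := fun h => hvB (h ▸ h2)
        simp only [Function.update_of_ne huv, Function.update_of_ne hsv]
        exact ⟨h1, .inr h2, h3⟩
    · rintro u (rfl | hu) huN ho w hw he
      · have hwB := hother ho w hw he
        have hwu : w ≠ u := fun h => hvB (h ▸ hwB)
        simp only [Function.update_self, Function.update_of_ne hwu]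
        exact ⟨.inr hwB, hM' w⟩
      · have huv : u ≠ v := fun h => hvB (h ▸ hu)
        obtain ⟨h2, h3⟩ := hB.other u hu huN ho w hw he
        have hwv : w ≠ v := fun h => hvB (h ▸ h2)
        simp only [Function.update_of_ne huv, Function.update_of_ne hwv]
        exact ⟨.inr h2, h3⟩
  refine ⟨B, s, ρ, hB, ⟨fun v hv hvB ho w hw he => ?_, fun v hv hvB ho => ?_⟩⟩
  · exact hins v hv hvB w (fun _ => ⟨he, hw⟩) (fun h => absurd ho h)
  · by_contra! hcon
    refine hins v hv hvB v (fun h => absurd h ho) fun _ w hw he => ?_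
    by_contra hwB
    exact hcon w hw hwB he

/-- The subarena `U` is covered by dominions of `P` and of the opponent of `P`. -/
def IsDetermined (G : ParityGame V) (P : Player) (U : Set V) : Prop :=
  ∃ X Y s t, G.IsDominion P U X s ∧ G.IsDominion P.opponent U Y t ∧ U ⊆ X ∪ Y

/-- Zielonka's argument: let P favor the top priority of U and remove P's attractor B to it. If the
opponent wins somewhere in the rest, that dominion survives in U; otherwise P wins all of U. -/
theorem exists_nonempty_isDominion [Finite V] {U : Set V} (hU : G.IsSubarena U)
    (hne : U.Nonempty)
    (ih : ∀ U' < U, G.IsSubarena U' → ∀ P, G.IsDetermined P U') :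
    ∃ P X s, X.Nonempty ∧ G.IsDominion P U X s := by
  classical
  obtain ⟨v₀, hv₀, hmax⟩ := U.toFinite.exists_maximalFor (fun v => (G.priority v : ℕ)) U hne
  have hmax : ∀ v ∈ U, (G.priority v : ℕ) ≤ G.priority v₀ :=
    fun v hv => (le_total _ _).elim id fun h => hmax hv h
  obtain ⟨P, hP⟩ := Player.exists_favors (G.priority v₀)
  have hNU : {v ∈ U | G.priority v = G.priority v₀} ⊆ U := fun v hv => hv.1
  obtain ⟨B, s, ρ, hB, hT⟩ := G.exists_isAttractor P hNU
  have hlt : U \ B < U := by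
    refine Set.sdiff_subset.ssubset_of_ne fun h => ?_
    exact (h.symm ▸ hv₀ : v₀ ∈ U \ B).2 (hB.target_subset ⟨hv₀, rfl⟩)
  obtain ⟨X, Y, s', t, hX, hY, hXY⟩ := ih _ hlt (hT.isSubarena_diff hU) P
  rcases Y.eq_empty_or_nonempty with rfl | hYne
  swap
  · exact ⟨P.opponent, Y, t, hYne, hT.isDominion_opponent hY⟩
  have hXU : X = U \ B := hX.subset.antisymm (by simpa using hXY)
  subst hXU
  choose! g hgU hg using hU
  let u : V → V := fun v => if v ∈ B then if G.priority v = G.priority v₀ then g v else s v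
    else s' v
  refine ⟨P, U, u, hne, subset_rfl, fun v hv ho => ?_, fun v _ _ w hw _ => hw, ?_⟩
  · by_cases hvB : v ∈ B
    · by_cases hp : G.priority v = G.priority v₀
      · simpa [u, hvB, hp] using ⟨hg v hv, hgU v hv⟩
      · have := hB.own v hvB (fun h => hp h.2) ho
        simpa [u, hvB, hp] using ⟨this.1, hB.subset this.2.1⟩
    · have := hX.own v ⟨hv, hvB⟩ ho
      simpa [u, hvB] using ⟨this.1, this.2.1⟩
  · intro π hπ hπU ha
    -- Either the top priority recurs, or the play eventually avoids B, as each visit to B leads to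
    -- the top priority again. In the second case the strategy on U \ B wins.
    by_cases hf : ∃ᶠ n in atTop, (G.priority (π n) : ℕ) = G.priority v₀
    · exact (Player.winsSequence_iff_favors hf (.of_forall fun n => hmax _ (hπU n))).mpr hP
    · obtain ⟨N, hN⟩ := eventually_atTop.mp (not_frequently.mp hf)
      have hnB : ∀ n ≥ N, π n ∉ B := by
        intro n hn hnB
        obtain ⟨m, hm, hmN⟩ := hB.exists_mem hπ hπU (fun n hn hn' ho => by
          have hp : ¬ G.priority (π n) = G.priority v₀ := fun h => hn' ⟨hπU n, h⟩
          rw [ha n ho]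
          simp [u, hn, hp]) n hnB
        exact hN m (hn.trans hm) (congrArg Fin.val hmN.2)
      rw [← Player.winsSequence_add_iff N]
      refine hX.wins _ (hπ.add N) (fun n => ⟨hπU _, hnB _ (by omega)⟩) fun n ho => ?_
      refine (ha.add N n ho).trans ?_
      simp [u, hnB (n + N) (by omega)]

theorem IsDetermined.symm {P : Player} {U : Set V} (h : G.IsDetermined P U) :
    G.IsDetermined P.opponent U := by
  obtain ⟨X, Y, s, t, hX, hY, hXY⟩ := h
  exact ⟨Y, X, t, s, hY, by rwa [Player.opponent_opponent], hXY.trans (Set.union_comm _ _).subset⟩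

/-- Positional determinacy of finite parity games. -/
theorem isDetermined [Finite V] (P : Player) (U : Set V) (hU : G.IsSubarena U) :
    G.IsDetermined P U := by
  induction U using WellFoundedLT.induction generalizing P with
  | _ U ih =>
    rcases U.eq_empty_or_nonempty with rfl | hne
    · refine ⟨∅, ∅, id, id, ?_, ?_, by simp⟩ <;>
        exact ⟨subset_rfl, by simp, by simp, fun π _ h => absurd (h 0) (by simp)⟩
    obtain ⟨Q, X, s, hXne, hX⟩ := exists_nonempty_isDominion hU hne
      fun U' hlt hU' P => ih U' hlt P hU'
    suffices G.IsDetermined Q U by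
      by_cases h : Q = P
      · exact h ▸ this
      · have hQ : Q.opponent = P := by
          cases P <;> cases Q <;> simp_all [Player.opponent]
        exact hQ ▸ this.symm
    -- The dominion is enlarged to its attractor so that what remains is a smaller subarena.
    obtain ⟨B, t, ρ, hB, hT⟩ := G.exists_isAttractor Q hX.subset
    obtain ⟨u, hu⟩ := hX.exists_of_isAttractor hB
    obtain ⟨v, hv⟩ := hXne
    have hlt : U \ B < U := by
      refine Set.sdiff_subset.ssubset_of_ne fun h => ?_
      exact (h.symm ▸ hX.subset hv : v ∈ U \ B).2 (hB.target_subset hv)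
    obtain ⟨X', Y', s', t', hX', hY', hXY'⟩ := ih _ hlt Q (hT.isSubarena_diff hU)
    obtain ⟨u', hu'⟩ := hu.union hX'
    refine ⟨B ∪ X', Y', u', t', hu', hT.isDominion_opponent hY', fun w hw => ?_⟩
    by_cases hwB : w ∈ B
    · exact .inl (.inl hwB)
    · exact (hXY' ⟨hw, hwB⟩).imp_left .inr

theorem IsDominion.subset_winningRegion {P : Player} {W : Set V} {s : V → V}
    (h : G.IsDominion P Set.univ W s) : W ⊆ G.winningRegion P := by
  classical
  intro v hv
  choose g hg using G.exists_succ
  refine ⟨fun v => if v ∈ W then s v else g v, fun u hu => ?_, fun π hπ h0 ha => ?_⟩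
  · by_cases huW : u ∈ W
    · simpa [huW] using (h.own u huW hu).1
    · simpa [huW] using hg u
  · have hmem := h.mem_of_agrees hπ (fun _ => trivial) (N := 0) (h0 ▸ hv)
      fun n hn ho => by simp [ha n ho, hn]
    refine h.wins π hπ hmem fun n ho => ?_
    have hn : π n ∈ W := hmem n
    simp [ha n ho, hn]


/-! ### Disjoint cycles inside sets of positions. -/

/-- There are `n` pairwise vertex-disjoint cycles inside the set `X`. -/
def HasDisjointCyclesIn (G : ParityGame V) (X : Set V) (n : ℕ) : Prop :=
  ∃ c : Fin n → Cycle V, (∀ i, G.IsCycle (c i)) ∧ (∀ i, ∀ v ∈ c i, v ∈ X) ∧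
    ∀ i j, i ≠ j → ∀ v, v ∈ c i → v ∉ c j

/-- The maximal number of pairwise vertex-disjoint cycles inside the set `X`. -/
noncomputable def dcSizeIn (G : ParityGame V) (X : Set V) : ℕ :=
  sSup {n | G.HasDisjointCyclesIn X n}

theorem exists_mem_of_isCycle {c : Cycle V} (h : G.IsCycle c) : ∃ v, v ∈ c := by
  induction c using Cycle.induction_on with
  | nil => exact absurd rfl h.1
  | cons a l => exact ⟨a, by simp⟩

/-- One position is picked from each cycle. The bound makes the supremum in `dcSize` a genuine
maximum. -/
theorem HasDisjointCycles.le_card [Finite V] {n : ℕ} (h : G.HasDisjointCycles n) :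
    n ≤ Nat.card V := by
  obtain ⟨c, hc, hd⟩ := h
  choose f hf using fun i => exists_mem_of_isCycle (hc i)
  have hinj : Function.Injective f := by
    intro i j hij
    by_contra hne
    exact hd i j hne _ (hf i) (hij ▸ hf j)
  simpa using Nat.card_le_card_of_injective f hinj

theorem HasDisjointCyclesIn.hasDisjointCycles {X : Set V} {n : ℕ}
    (h : G.HasDisjointCyclesIn X n) : G.HasDisjointCycles n :=
  let ⟨c, h1, _, h3⟩ := h
  ⟨c, h1, h3⟩

theorem bddAbove_hasDisjointCycles [Finite V] : BddAbove {n | G.HasDisjointCycles n} :=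
  ⟨Nat.card V, fun _ h => h.le_card⟩

theorem bddAbove_hasDisjointCyclesIn [Finite V] (X : Set V) :
    BddAbove {n | G.HasDisjointCyclesIn X n} :=
  bddAbove_hasDisjointCycles.mono fun _ h => h.hasDisjointCycles

theorem HasDisjointCyclesIn.le_dcSizeIn [Finite V] {X : Set V} {n : ℕ}
    (h : G.HasDisjointCyclesIn X n) : n ≤ G.dcSizeIn X :=
  le_csSup (bddAbove_hasDisjointCyclesIn X) h

theorem hasDisjointCyclesIn_dcSizeIn [Finite V] (X : Set V) :
    G.HasDisjointCyclesIn X (G.dcSizeIn X) :=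
  Nat.sSup_mem (s := {n | G.HasDisjointCyclesIn X n})
    ⟨0, fun i => i.elim0, fun i => i.elim0, fun i => i.elim0, fun i => i.elim0⟩
    (bddAbove_hasDisjointCyclesIn X)

theorem dcSizeIn_le_dcSize [Finite V] (X : Set V) : G.dcSizeIn X ≤ G.dcSize :=
  le_csSup bddAbove_hasDisjointCycles (hasDisjointCyclesIn_dcSizeIn X).hasDisjointCycles

theorem dcSizeIn_mono [Finite V] {X Y : Set V} (h : X ⊆ Y) : G.dcSizeIn X ≤ G.dcSizeIn Y := by
  obtain ⟨c, h1, h2, h3⟩ := G.hasDisjointCyclesIn_dcSizeIn X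
  exact HasDisjointCyclesIn.le_dcSizeIn ⟨c, h1, fun i v hv => h (h2 i v hv), h3⟩

theorem dcSizeIn_add_le [Finite V] {X Y Z : Set V} (hX : X ⊆ Z) (hY : Y ⊆ Z)
    (hd : Disjoint X Y) : G.dcSizeIn X + G.dcSizeIn Y ≤ G.dcSizeIn Z := by
  obtain ⟨c, h1, h2, h3⟩ := G.hasDisjointCyclesIn_dcSizeIn X
  obtain ⟨c', h1', h2', h3'⟩ := G.hasDisjointCyclesIn_dcSizeIn Y
  refine HasDisjointCyclesIn.le_dcSizeIn ⟨Fin.append c c', ?_, ?_, ?_⟩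
  · intro i
    induction i using Fin.addCases <;> simp [h1, h1']
  · intro i
    induction i using Fin.addCases with
    | left i => simpa using fun v hv => hX (h2 i v hv)
    | right i => simpa using fun v hv => hY (h2' i v hv)
  · intro i j hij v hv hv'
    induction i using Fin.addCases with
    | left i =>
      induction j using Fin.addCases with
      | left j =>
        simp only [Fin.append_left] at hv hv'
        exact h3 i j (fun h => hij (h ▸ rfl)) v hv hv'
      | right j =>
        simp only [Fin.append_left, Fin.append_right] at hv hv'
        exact Set.disjoint_left.mp hd (h2 i v hv) (h2' j v hv')
    | right i =>
      induction j using Fin.addCases with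
      | left j =>
        simp only [Fin.append_left, Fin.append_right] at hv hv'
        exact Set.disjoint_left.mp hd (h2 j v hv') (h2' i v hv)
      | right j =>
        simp only [Fin.append_right] at hv hv'
        exact h3' i j (fun h => hij (h ▸ rfl)) v hv hv'

/-- A play on a finite arena closes a simple cycle. -/
theorem exists_isCycle_of_isPlay [Finite V] {π : ℕ → V} (hπ : G.IsPlay π) :
    ∃ c, G.IsCycle c ∧ ∀ v ∈ c, ∃ n, v = π n := by
  classical
  have hex : ∃ L, ∃ i, π i = π (i + (L + 1)) := by
    obtain ⟨i, j, hne, hij⟩ := Finite.exists_ne_map_eq_of_infinite π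
    rcases lt_or_gt_of_ne hne with h | h
    · exact ⟨j - i - 1, i, by rw [hij]; congr 1; omega⟩
    · exact ⟨i - j - 1, j, by rw [← hij]; congr 1; omega⟩
  obtain ⟨i, hi⟩ := Nat.find_spec hex
  have hmin : ∀ m < Nat.find hex, ∀ j, π j ≠ π (j + (m + 1)) := by
    intro m hm j hj
    exact Nat.find_min hex hm ⟨j, hj⟩
  -- L + 1 is the least distance between two equal positions of the play, which makes the cycle
  -- simple.
  set L := Nat.find hex
  refine ⟨((List.range (L + 1)).map fun n => π (i + n) : List V), ⟨?_, ?_, ?_⟩, ?_⟩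
  · simp [Cycle.coe_eq_nil]
  · rw [Cycle.nodup_coe_iff]
    refine List.Nodup.map_on (fun a ha b hb hab => ?_) List.nodup_range
    simp only [List.mem_range] at ha hb
    rcases lt_trichotomy a b with h | h | h
    · refine absurd hab ?_
      have := hmin (b - a - 1) (by omega) (i + a)
      rwa [show i + a + (b - a - 1 + 1) = i + b by omega] at this
    · exact h
    · refine absurd hab.symm ?_
      have := hmin (a - b - 1) (by omega) (i + b)
      rwa [show i + b + (a - b - 1 + 1) = i + a by omega] at this
  · rw [List.range_succ_eq_map, List.map_cons, Cycle.chain_coe_cons]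
    have : π (i + 0) :: (List.map (fun n => π (i + n)) (List.map Nat.succ (List.range L)) ++
        [π (i + 0)]) = (List.range (L + 2)).map fun n => π (i + n) := by
      rw [List.range_succ, List.range_succ_eq_map]
      simp [hi]
    rw [this, List.isChain_iff_getElem]
    intro n hn
    simpa [← add_assoc] using hπ (i + n)
  · intro v hv
    simp only [Cycle.mem_coe_iff, List.mem_map] at hv
    obtain ⟨n, -, rfl⟩ := hv
    exact ⟨_, rfl⟩

theorem one_le_dcSizeIn [Finite V] {X : Set V} {π : ℕ → V} (hπ : G.IsPlay π)
    (hX : ∀ n, π n ∈ X) : 1 ≤ G.dcSizeIn X := by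
  obtain ⟨c, hc, hcπ⟩ := exists_isCycle_of_isPlay hπ
  refine HasDisjointCyclesIn.le_dcSizeIn ⟨fun _ => c, fun _ => hc, fun _ v hv => ?_, fun i j h => ?_⟩
  · obtain ⟨n, rfl⟩ := hcπ v hv
    exact hX n
  · exact absurd (Subsingleton.elim i j) h

/-! ### Components and closed walks of bounded priority. -/

/-- The edges which agree with the strategy `s` of `P` and join positions of priority at
most `p`. -/
def BoundedEdge (G : ParityGame V) (P : Player) (s : V → V) (p : ℕ) (u w : V) : Prop :=
  G.edge u w ∧ (G.owner u = P → w = s u) ∧ (G.priority u : ℕ) ≤ p ∧ (G.priority w : ℕ) ≤ p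

/-- The strongly connected component of `v` in the graph of `BoundedEdge` for the priority
of `v`. -/
def component (G : ParityGame V) (P : Player) (s : V → V) (v : V) : Set V :=
  {w | Relation.ReflTransGen (G.BoundedEdge P s (G.priority v)) v w ∧
    Relation.ReflTransGen (G.BoundedEdge P s (G.priority v)) w v}

open Relation

theorem reflTransGen_boundedEdge_mono {P : Player} {s : V → V} {p q : ℕ} (h : p ≤ q) {u w : V}
    (huw : ReflTransGen (G.BoundedEdge P s p) u w) :
    ReflTransGen (G.BoundedEdge P s q) u w :=
  ReflTransGen.mono (r := G.BoundedEdge P s p)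
    (fun _ _ ⟨h1, h2, h3, h4⟩ => ⟨h1, h2, h3.trans h, h4.trans h⟩) _ _ huw

theorem transGen_boundedEdge_of_isPlay {P : Player} {s : V → V} {π : ℕ → V} (hπ : G.IsPlay π)
    (ha : G.Agrees P s π) {q m n : ℕ} (hmn : m < n)
    (hq : ∀ j, m ≤ j → j ≤ n → (G.priority (π j) : ℕ) ≤ q) :
    TransGen (G.BoundedEdge P s q) (π m) (π n) := by
  induction n, hmn using Nat.le_induction with
  | base => exact .single ⟨hπ m, ha m, hq _ le_rfl (by omega), hq _ (by omega) le_rfl⟩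
  | succ n hmn ih =>
    exact (ih fun j h1 h2 => hq j h1 (by omega)).tail
      ⟨hπ n, ha n, hq _ (by omega) (by omega), hq _ (by omega) le_rfl⟩

theorem reflTransGen_boundedEdge_of_isPlay {P : Player} {s : V → V} {π : ℕ → V}
    (hπ : G.IsPlay π) (ha : G.Agrees P s π) {q m n : ℕ} (hmn : m ≤ n)
    (hq : ∀ j, m ≤ j → j ≤ n → (G.priority (π j) : ℕ) ≤ q) :
    ReflTransGen (G.BoundedEdge P s q) (π m) (π n) := by
  rcases hmn.eq_or_lt with rfl | h
  · exact .refl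
  · exact (transGen_boundedEdge_of_isPlay hπ ha h hq).to_reflTransGen

theorem exists_path_of_transGen {r : V → V → Prop} {a b : V} (h : TransGen r a b) :
    ∃ (L : ℕ) (x : ℕ → V), x 0 = a ∧ x (L + 1) = b ∧ ∀ i ≤ L, r (x i) (x (i + 1)) := by
  classical
  induction h with
  | @single b h =>
    refine ⟨0, fun i => if i = 0 then a else b, by simp, by simp, fun i hi => ?_⟩
    obtain rfl : i = 0 := by omega
    simpa using h
  | @tail b c _ hbc ih =>
    obtain ⟨L, x, h0, hL, hx⟩ := ih
    refine ⟨L + 1, fun i => if i = L + 2 then c else x i, by simpa using h0, by simp,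
      fun i hi => ?_⟩
    have hi2 : i ≠ L + 2 := by omega
    rcases hi.eq_or_lt with rfl | hi'
    · simpa [hL] using hbc
    · have : i + 1 ≠ L + 2 := by omega
      simpa [hi2, show i ≠ L + 1 by omega] using hx i (by omega)

/-- A closed walk through `a` yields an infinite walk that visits `a` infinitely often. -/
theorem exists_walk_of_transGen {r : V → V → Prop} {a : V} (h : TransGen r a a) :
    ∃ x : ℕ → V, x 0 = a ∧ (∃ᶠ n in atTop, x n = a) ∧ ∀ n, r (x n) (x (n + 1)) := by
  obtain ⟨L, x, h0, hL, hx⟩ := exists_path_of_transGen h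
  refine ⟨fun n => x (n % (L + 1)), by simpa using h0, frequently_atTop.mpr fun N => ?_,
    fun n => ?_⟩
  · exact ⟨N * (L + 1), Nat.le_mul_of_pos_right _ (Nat.succ_pos _), by simpa using h0⟩
  · have hlt : n % (L + 1) < L + 1 := Nat.mod_lt n (Nat.succ_pos L)
    have hr := hx (n % (L + 1)) (by omega)
    rcases (Nat.le_of_lt_succ hlt).eq_or_lt with h | h
    · have : (n + 1) % (L + 1) = 0 := by
        rw [Nat.add_mod, h]
        rcases L with _ | L
        · simp
        · simp [Nat.mod_eq_of_lt (show 1 < L + 1 + 1 by omega)]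
      rw [h, hL] at hr
      simp only [h, this, h0]
      exact hr
    · have : (n + 1) % (L + 1) = n % (L + 1) + 1 := by
        rw [Nat.add_mod, Nat.mod_eq_of_lt (show 1 < L + 1 by omega), Nat.mod_eq_of_lt]
        omega
      simp only [this]
      exact hr

/-- Going round the closed walk forever is an s-consistent play in which the priority of a recurs
and is maximal. -/
theorem IsDominion.favors_of_transGen {P : Player} {W : Set V} {s : V → V}
    (h : G.IsDominion P Set.univ W s) {a : V} (ha : a ∈ W)
    (hcyc : TransGen (G.BoundedEdge P s (G.priority a)) a a) : P.Favors (G.priority a) := by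
  obtain ⟨x, h0, hf, hx⟩ := exists_walk_of_transGen hcyc
  have hπ : G.IsPlay x := fun n => (hx n).1
  have hs : G.Agrees P s x := fun n ho => (hx n).2.1 ho
  have hmem := h.mem_of_agrees hπ (fun _ => trivial) (N := 0) (h0 ▸ ha) fun n _ ho => hs n ho
  refine (Player.winsSequence_iff_favors (hf.mono fun n hn => by rw [hn])
    (.of_forall fun n => (hx n).2.2.1)).mp (h.wins x hπ hmem hs)

/-! ### Ranks of positions and outputs of the registers. -/

/-- The register chosen at `v`. -/
noncomputable def registerRank (G : ParityGame V) (P : Player) (s : V → V) (v : V) : ℕ :=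
  Nat.size (G.dcSizeIn (G.component P s v))

theorem registerRank_le [Finite V] (P : Player) (s : V → V) (v : V) :
    G.registerRank P s v ≤ Nat.size G.dcSize :=
  Nat.size_le_size (dcSizeIn_le_dcSize _)

theorem component_subset {P : Player} {s : V → V} {u v : V} {p : ℕ}
    (hp : (G.priority v : ℕ) = p) (hu : (G.priority u : ℕ) ≤ p)
    (huv : ReflTransGen (G.BoundedEdge P s p) u v)
    (hvu : ReflTransGen (G.BoundedEdge P s p) v u) :
    G.component P s u ⊆ G.component P s v := by
  subst hp
  rintro w ⟨h1, h2⟩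
  exact ⟨hvu.trans (reflTransGen_boundedEdge_mono hu h1),
    (reflTransGen_boundedEdge_mono hu h2).trans huv⟩

theorem IsDominion.favors_of_registerRank_eq [Finite V] {P : Player} {W : Set V} {s : V → V}
    (h : G.IsDominion P Set.univ W s) {π : ℕ → V} (hπ : G.IsPlay π) (ha : G.Agrees P s π)
    (hW : ∀ n, π n ∈ W) {v : V} {k m n j : ℕ} (hmn : m < n) (hmj : m ≤ j) (hjn : j ≤ n)
    (hmax : ∀ i, m ≤ i → i ≤ n → (G.priority (π i) : ℕ) ≤ G.priority (π j))
    (hk : k ≠ 0) (hv : G.registerRank P s v = k)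
    (hm : G.registerRank P s (π m) = k) (hn : G.registerRank P s (π n) = k)
    (hmv : G.component P s (π m) ⊆ G.component P s v)
    (hnv : G.component P s (π n) ⊆ G.component P s v) : P.Favors (G.priority (π j)) := by
  have hdisj : ¬ Disjoint (G.component P s (π m)) (G.component P s (π n)) := by
    intro hd
    have hadd := G.dcSizeIn_add_le hmv hnv hd
    -- With k now the predecessor, both components have at least 2^k disjoint cycles, while that of
    -- v has fewer than 2^(k+1).
    obtain ⟨k, rfl⟩ := Nat.exists_eq_succ_of_ne_zero hk
    have hm' := Nat.lt_size.mp (hm ▸ Nat.lt_succ_self k : k < G.registerRank P s (π m))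
    have hn' := Nat.lt_size.mp (hn ▸ Nat.lt_succ_self k : k < G.registerRank P s (π n))
    have hv' := Nat.size_le.mp hv.le
    rw [pow_succ] at hv'
    omega
  obtain ⟨y, hym, hyn⟩ := Set.not_disjoint_iff.mp hdisj
  refine h.favors_of_transGen (hW j) ?_
  -- The way back from π n to π m leads through the common position y.
  have hback := (reflTransGen_boundedEdge_mono (hmax n hmn.le le_rfl) hyn.1).trans
    (reflTransGen_boundedEdge_mono (hmax m le_rfl hmn.le) hym.2)
  rcases hmj.eq_or_lt with rfl | hmj
  · exact (transGen_boundedEdge_of_isPlay hπ ha hmn hmax).trans_left hback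
  · exact .trans_right ((reflTransGen_boundedEdge_of_isPlay hπ ha hjn
      fun i h1 h2 => hmax i (by omega) h2).trans hback)
      (transGen_boundedEdge_of_isPlay hπ ha hmj fun i h1 h2 => hmax i h1 (by omega))

/-- Only the parity of m matters; 0 and 1 are representatives of the favored parity, so all good
outputs of a register coincide. -/
theorem registerOutput_of_favors {P : Player} {i m : ℕ} (h : P.Favors m) :
    registerOutput P i m = registerOutput P i (if P = .eve then 0 else 1) := by
  cases P <;> simp_all [registerOutput, Player.Favors]

theorem registerOutput_le_of_lt {P : Player} {i k m m' : ℕ} (h : i < k) :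
    registerOutput P i m ≤ registerOutput P k m' := by
  cases P <;> simp only [registerOutput] <;> split_ifs <;> omega

theorem favors_registerOutput {P : Player} {i m : ℕ} (h : P.Favors m) :
    P.Favors (registerOutput P i m) := by
  cases P with
  | eve => simp_all [registerOutput, Player.Favors]
  | adam =>
    have : ¬ Even m := h
    simp [registerOutput, Player.Favors, this]

/-- The sequence of priorities that arises in the register game when register
`registerRank` is always chosen along a play in a dominion is winning. -/
theorem IsDominion.winsSequence_registerOutput [Finite V] {P : Player} {W : Set V} {s : V → V}
    (h : G.IsDominion P Set.univ W s) {K : ℕ} {f : V → Fin (K + 1)}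
    (hf : ∀ v, (f v : ℕ) = G.registerRank P s v) {π : ℕ → V} (hπ : G.IsPlay π)
    (ha : G.Agrees P s π) (hW : ∀ n, π n ∈ W) {r : ℕ → G.Registers K} {c : ℕ → ℕ}
    (hr : ∀ n, r (n + 1) = G.updateRegisters (r n) (G.priority (π n)) (f (π n)))
    (hc : ∀ n, c (2 * n) = registerOutput P (f (π n))
      (max (r n (f (π n))) (G.priority (π n)) : Fin (G.maxPriority + 1)))
    (hc' : ∀ n, c (2 * n + 1) = 0) : P.WinsSequence c := by
  obtain ⟨p, hfp, hlep⟩ := exists_frequently_eq_and_eventually_le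
    (c := fun n => (G.priority (π n) : ℕ)) (B := G.maxPriority)
    fun n => Nat.le_of_lt_succ (G.priority (π n)).isLt
  have hp : P.Favors p := (Player.winsSequence_iff_favors hfp hlep).mp (h.wins π hπ hW ha)
  obtain ⟨v, hv⟩ : ∃ v, ∃ᶠ n in atTop, π n = v ∧ (G.priority (π n) : ℕ) = p := by
    by_contra! hcon
    have := eventually_all.mpr hcon
    obtain ⟨n, hn, hn'⟩ := (hfp.and_eventually this).exists
    exact hn' (π n) rfl hn
  obtain ⟨N', hN'⟩ := eventually_atTop.mp hlep
  obtain ⟨N, hNN', hNv, hNp⟩ := frequently_atTop.mp hv N'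
  have hle : ∀ n ≥ N, (G.priority (π n) : ℕ) ≤ p := fun n hn => hN' n (hNN'.trans hn)
  have hvp : (G.priority v : ℕ) = p := hNv ▸ hNp
  have hreach : ∀ n ≥ N, ReflTransGen (G.BoundedEdge P s p) v (π n) ∧
      ReflTransGen (G.BoundedEdge P s p) (π n) v := by
    intro n hn
    obtain ⟨n', hn', hv', -⟩ := frequently_atTop.mp hv n
    constructor
    · have := reflTransGen_boundedEdge_of_isPlay hπ ha hn fun j h1 _ => hle j h1
      rwa [hNv] at this
    · have := reflTransGen_boundedEdge_of_isPlay hπ ha hn' fun j h1 _ => hle j (hn.le.trans h1)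
      rwa [hv'] at this
  have hsub : ∀ n ≥ N, G.component P s (π n) ⊆ G.component P s v := fun n hn =>
    component_subset hvp (hle n hn) (hreach n hn).2 (hreach n hn).1
  have hrank : ∀ n ≥ N, f (π n) ≤ f v := fun n hn => by
    rw [Fin.le_def, hf, hf]
    exact Nat.size_le_size (dcSizeIn_mono (hsub n hn))
  -- The tail of the play stays in the component of v and closes a cycle there.
  have hk : (f v : ℕ) ≠ 0 := by
    have h1 : 1 ≤ G.dcSizeIn (G.component P s v) := one_le_dcSizeIn (hπ.add N) fun n => by
      have := hreach (n + N) (by omega)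
      rwa [← hvp] at this
    rw [hf]
    exact (Nat.size_pos.mpr h1).ne'
  -- Register `f v` is overwritten when chosen at m and then accumulates priorities while smaller
  -- registers are chosen, so at n it holds the maximum over [m, n).
  have hinv : ∀ n > N, ∃ m, N ≤ m ∧ m < n ∧ f (π m) = f v ∧
      (∃ j, m ≤ j ∧ j < n ∧ r n (f v) = G.priority (π j)) ∧
      ∀ j, m ≤ j → j < n → G.priority (π j) ≤ r n (f v) := by
    intro n hn
    have hset : ∀ n ≥ N, f (π n) = f v → ∃ m, N ≤ m ∧ m < n + 1 ∧ f (π m) = f v ∧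
        (∃ j, m ≤ j ∧ j < n + 1 ∧ r (n + 1) (f v) = G.priority (π j)) ∧
        ∀ j, m ≤ j → j < n + 1 → G.priority (π j) ≤ r (n + 1) (f v) := by
      intro n hn hfn
      have hrn : r (n + 1) (f v) = G.priority (π n) := by
        simp [hr, updateRegisters, hfn]
      refine ⟨n, hn, n.lt_succ_self, hfn, ⟨n, le_rfl, n.lt_succ_self, hrn⟩, fun j h1 h2 => ?_⟩
      obtain rfl : j = n := by omega
      exact hrn.ge
    induction n, hn using Nat.le_induction with
    | base => exact hset N le_rfl (by rw [hNv])
    | succ n hn ih =>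
      by_cases hfn : f (π n) = f v
      · exact hset n (by omega) hfn
      have hlt : f (π n) < f v := lt_of_le_of_ne (hrank n (by omega)) hfn
      have hrn : r (n + 1) (f v) = max (r n (f v)) (G.priority (π n)) := by
        simp [hr, updateRegisters, hlt]
      obtain ⟨m, h1, h2, h3, ⟨j, h4, h5, h6⟩, h7⟩ := ih
      refine ⟨m, h1, by omega, h3, ?_, fun i hi hi' => ?_⟩
      · rcases le_total (r n (f v)) (G.priority (π n)) with h | h
        · exact ⟨n, by omega, by omega, by rw [hrn, max_eq_right h]⟩
        · exact ⟨j, h4, by omega, by rw [hrn, max_eq_left h, h6]⟩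
      · rw [hrn]
        rcases (Nat.le_of_lt_succ hi').eq_or_lt with rfl | hi'
        · exact le_max_right _ _
        · exact (h7 i hi hi').trans (le_max_left _ _)
  have hgood : ∀ n > N, f (π n) = f v →
      P.Favors (max (r n (f v)) (G.priority (π n)) : Fin (G.maxPriority + 1)) := by
    intro n hn hfn
    obtain ⟨m, h1, h2, h3, ⟨j, h4, h5, h6⟩, h7⟩ := hinv n hn
    have key : ∀ i, m ≤ i → i ≤ n →
        (∀ l, m ≤ l → l ≤ n → G.priority (π l) ≤ G.priority (π i)) →
        P.Favors (G.priority (π i)) := fun i hi hi' hmax =>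
      h.favors_of_registerRank_eq hπ ha hW h2 hi hi' hmax hk (hf v).symm
        (by rw [← hf, h3]) (by rw [← hf, hfn]) (hsub m h1) (hsub n hn.le)
    rcases le_total (r n (f v)) (G.priority (π n)) with h | h
    · rw [max_eq_right h]
      refine key n h2.le le_rfl fun l hl hl' => ?_
      rcases hl'.eq_or_lt with rfl | hl'
      · exact le_rfl
      · exact (h7 l hl hl').trans h
    · rw [max_eq_left h, h6]
      refine key j h4 h5.le fun l hl hl' => h6 ▸ ?_
      rcases hl'.eq_or_lt with rfl | hl'
      · exact h
      · exact h7 l hl hl'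
  have hfc : ∃ᶠ n in atTop, c n = registerOutput P (f v) p := by
    refine frequently_atTop.mpr fun M => ?_
    obtain ⟨n, hn, hnv, -⟩ := frequently_atTop.mp hv (max M (N + 1))
    have hfn : f (π n) = f v := by rw [hnv]
    refine ⟨2 * n, by omega, ?_⟩
    rw [hc, hfn, registerOutput_of_favors (hgood n (by omega) hfn), registerOutput_of_favors hp]
  -- The output at index 2N is skipped: it may depend on the uncontrolled content of the register
  -- before its choice at time N.
  refine (Player.winsSequence_iff_favors hfc (eventually_atTop.mpr ⟨2 * N + 1, fun i hi => ?_⟩)).mpr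
    (favors_registerOutput hp)
  obtain ⟨n, rfl | rfl⟩ := Nat.even_or_odd' i
  · rcases (hrank n (by omega)).eq_or_lt with hfn | hfn
    · rw [hc, hfn, registerOutput_of_favors (hgood n (by omega) hfn), registerOutput_of_favors hp]
    · rw [hc]
      exact registerOutput_le_of_lt hfn
  · rw [hc']
    exact Nat.zero_le _

/-! ### The winning strategy in the register game. -/

theorem IsDominion.winsRegisterGame [Finite V] {P : Player} {W : Set V} {s : V → V}
    (h : G.IsDominion P Set.univ W s) {v : V} (hv : v ∈ W) :
    G.WinsRegisterGame (Nat.size G.dcSize) P v := by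
  classical
  intro r₀ t₀
  choose g hg using G.exists_succ
  let f : V → Fin (Nat.size G.dcSize + 1) :=
    fun v => ⟨G.registerRank P s v, Nat.lt_succ_of_le (registerRank_le P s v)⟩
  -- Outside W the moves are arbitrary, only there to make σ a strategy; the play never leaves W.
  let σ : G.RegisterPosition (Nat.size G.dcSize) → ℕ × G.RegisterPosition (Nat.size G.dcSize) :=
    fun x => if x.2.2 then (0, if x.1 ∈ W then s x.1 else g x.1, x.2.1, false)
      else (registerOutput P (f x.1)
        (max (x.2.1 (f x.1)) (G.priority x.1) : Fin (G.maxPriority + 1)),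
        x.1, G.updateRegisters x.2.1 (G.priority x.1) (f x.1), true)
  refine ⟨σ, ?_, fun ρ c hρ h0 ha => ?_⟩
  · rintro ⟨u, r, _ | _⟩ ho
    · exact .choose u r (f u)
    · refine .move u _ r ?_
      by_cases hu : u ∈ W
      · simpa [hu] using (h.own u hu ho).1
      · simpa [hu] using hg u
  have hchoose : ∀ i, (ρ i).2.2 = false → (c i, ρ (i + 1)) = σ (ρ i) := fun i hi =>
    ha i (by simp [registerGame, hi])
  have hmove : ∀ i, (ρ i).2.2 = true → c i = 0 ∧ (ρ (i + 1)).2 = ((ρ i).2.1, false) ∧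
      G.edge (ρ i).1 (ρ (i + 1)).1 := by
    intro i hi
    have he : G.RegisterEdge _ P (ρ i) (c i) (ρ (i + 1)) := hρ i
    generalize ρ i = x, c i = d, ρ (i + 1) = y at he hi
    cases he with
    | move u w r he => exact ⟨rfl, rfl, he⟩
    | choose u r i => simp at hi
  have hmoveOwn : ∀ i, (ρ i).2.2 = true → (ρ i).1 ∈ W → G.owner (ρ i).1 = P →
      (ρ (i + 1)).1 = s (ρ i).1 := by
    intro i hi hW ho
    have := congrArg (fun x => x.2.1) (ha i (by simpa [registerGame, hi] using ho))
    simpa [σ, hi, hW] using this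
  have hW : ∀ i, (ρ i).1 ∈ W := by
    intro i
    induction i with
    | zero => simpa [h0] using hv
    | succ i ih =>
      cases hi : (ρ i).2.2
      · have := congrArg (fun x => x.2.1) (hchoose i hi)
        simp only [σ, hi] at this
        simpa [this] using ih
      · by_cases ho : G.owner (ρ i).1 = P
        · rw [hmoveOwn i hi ih ho]
          exact (h.own _ ih ho).2
        · exact h.other _ ih ho _ trivial (hmove i hi).2.2
  -- The play may start with a move in G; shifting by b puts the register choices at even times.
  obtain ⟨b, hb⟩ : ∃ b, (ρ b).2.2 = false := by
    cases ht : t₀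
    · exact ⟨0, by simp [h0, ht]⟩
    · exact ⟨1, by simp [(hmove 0 (by simp [h0, ht])).2.1]⟩
  have hpar : ∀ n, (ρ (2 * n + b)).2.2 = false ∧ (ρ (2 * n + 1 + b)).2.2 = true := by
    have hstep : ∀ i, (ρ i).2.2 = false → (ρ (i + 1)).2.2 = true := by
      intro i hi
      have := congrArg (fun x => x.2.2.2) (hchoose i hi)
      simpa [σ, hi] using this
    intro n
    induction n with
    | zero => exact ⟨by simpa using hb, by simpa [add_comm] using hstep b hb⟩
    | succ n ih =>
      have h1 : (ρ (2 * (n + 1) + b)).2.2 = false := by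
        rw [show 2 * (n + 1) + b = 2 * n + 1 + b + 1 by ring, (hmove _ ih.2).2.1]
      refine ⟨h1, ?_⟩
      rw [show 2 * (n + 1) + 1 + b = 2 * (n + 1) + b + 1 by ring]
      exact hstep _ h1
  have hch : ∀ n, (c (2 * n + b), ρ (2 * n + 1 + b)) = σ (ρ (2 * n + b)) := fun n => by
    rw [← hchoose _ (hpar n).1, show 2 * n + 1 + b = 2 * n + b + 1 by ring]
  have hmv : ∀ n, c (2 * n + 1 + b) = 0 ∧
      (ρ (2 * (n + 1) + b)).2 = ((ρ (2 * n + 1 + b)).2.1, false) ∧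
      G.edge (ρ (2 * n + 1 + b)).1 (ρ (2 * (n + 1) + b)).1 := fun n => by
    have := hmove _ (hpar n).2
    rwa [show 2 * n + 1 + b + 1 = 2 * (n + 1) + b by ring] at this
  have hpos : ∀ n, (ρ (2 * n + 1 + b)).1 = (ρ (2 * n + b)).1 := fun n => by
    have := congrArg (fun x => x.2.1) (hch n)
    simpa [σ, (hpar n).1] using this
  rw [← Player.winsSequence_add_iff b]
  refine h.winsSequence_registerOutput (f := f) (fun _ => rfl)
    (π := fun n => (ρ (2 * n + b)).1) (r := fun n => (ρ (2 * n + b)).2.1)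
    (fun n => ?_) (fun n ho => ?_) (fun n => hW _) (fun n => ?_) (fun n => ?_) fun n => (hmv n).1
  · simpa only [hpos] using (hmv n).2.2
  · have := hmoveOwn (2 * n + 1 + b) (hpar n).2 (hW _) (by rw [hpos]; exact ho)
    rwa [hpos, show 2 * n + 1 + b + 1 = 2 * (n + 1) + b by ring] at this
  · have := congrArg (fun x => x.2.2.1) (hch n)
    simp only [(hmv n).2.1]
    simpa [σ, (hpar n).1] using this
  · have := congrArg Prod.fst (hch n)
    simpa [σ, (hpar n).1] using this

/-! ### Existence of the register-index and the logarithmic bound. -/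

theorem exists_hasRegisterIndexAt [Finite V] (v : V) :
    ∃ j ≤ Nat.size G.dcSize, G.HasRegisterIndexAt v j := by
  classical
  obtain ⟨X, Y, s, t, hX, hY, hXY⟩ := isDetermined (G := G) .eve Set.univ fun v _ =>
    let ⟨w, hw⟩ := G.exists_succ v
    ⟨w, trivial, hw⟩
  have key : ∀ C, G.WinsRegisterGame (Nat.size G.dcSize) C v →
      ∃ j ≤ Nat.size G.dcSize, IsLeast {j | G.WinsRegisterGame j C v} j := fun C hC =>
    have hex : ∃ j, G.WinsRegisterGame j C v := ⟨_, hC⟩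
    ⟨Nat.find hex, Nat.find_min' hex hC, Nat.find_spec hex, fun _ hj => Nat.find_min' hex hj⟩
  rcases hXY (Set.mem_univ v) with hv | hv
  · obtain ⟨j, hj, hl⟩ := key .eve (hX.winsRegisterGame hv)
    exact ⟨j, hj, .inl ⟨hX.subset_winningRegion hv, hl⟩⟩
  · obtain ⟨j, hj, hl⟩ := key .adam (hY.winsRegisterGame hv)
    exact ⟨j, hj, .inr ⟨hY.subset_winningRegion hv, hl⟩⟩

theorem size_le_one_add_logb {n : ℕ} : (Nat.size n : ℝ) ≤ 1 + Real.logb 2 n := by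
  -- For n = 0 the bound holds because `Real.logb 2 0` is 0 by convention.
  rcases Nat.eq_zero_or_pos n with rfl | hn
  · simp
  obtain ⟨k, hk⟩ := Nat.exists_eq_succ_of_ne_zero (Nat.size_pos.mpr hn).ne'
  have h2 : 2 ^ k ≤ n := Nat.lt_size.mp (hk ▸ Nat.lt_succ_self k)
  have : (k : ℝ) ≤ Real.logb 2 n := by
    rw [Real.le_logb_iff_rpow_le one_lt_two (by exact_mod_cast hn), Real.rpow_natCast]
    exact_mod_cast h2
  rw [hk]
  push_cast
  linarith

end ParityGame

theorem mainTheorem1 {V : Type*} [Finite V] [Nonempty V] (G : ParityGame V) :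
    ∃ k : ℕ, G.HasRegisterIndex k ∧ (k : ℝ) ≤ 1 + Real.logb 2 (G.dcSize : ℝ) := by
  classical
  have hsize : ∀ v, ∃ j ≤ Nat.size G.dcSize, G.HasRegisterIndexAt v j :=
    G.exists_hasRegisterIndexAt
  have hex : ∃ m, ∀ v, ∃ j ≤ m, G.HasRegisterIndexAt v j := ⟨_, hsize⟩
  refine ⟨Nat.find hex, ⟨Nat.find_spec hex, fun _ hm => Nat.find_min' hex hm⟩, ?_⟩
  exact (Nat.cast_le.mpr (Nat.find_min' hex hsize)).trans ParityGame.size_le_one_add_logb
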